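/- Write $\mathbb{R}^2_+=\{(r,z): r>0\}$, $\nabla=(\partial_r,\partial_z)$. Let $\sigma>0$ (surface tension) and $\rho>0$ (density). Let $E$ be a bounded convex set with nonempty interior, $\overline E\subset\mathbb{R}^2_+$, symmetric under $z\mapsto -z$, with $C^2$ boundary; $n$ is the unit normal of $\partial E$ pointing out of $E$, $\kappa$ the curvature of $\partial E$ (positive where $E$ is strictly convex), and $H=\kappa+\frac{n\cdot e_r}{r}$. A solution $(E,\psi,W,\gamma,\lambda)$ consists of such a set $E$, real constants $W,\gamma,\lambda$ and a function $\psi$ which is $C^2$ in $\mathbb{R}^2_+\setminus\overline E$, continuous up to the boundary $\partial E\cup\partial\mathbb{R}^2_+$, has a normal derivative $\partial_n\psi$ on $\partial E$ from the exterior, and satisfies \[ -\operatorname{div}\Big(\frac1r\nabla\psi\Big)=0\ \text{ in }\mathbb{R}^2_+\setminus\overline E,\qquad \psi-\frac W2r^2=\gamma\ \text{ on }\partial E, \] \[ 2\sigma H-\rho\Big(\frac1r\partial_n\psi-W\,n\cdot e_r\Big)^2+\lambda=0\ \text{ on }\partial E,\qquad \psi=0\ \text{ on }\partial\mathbb{R}^2_+,\qquad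 \psi\to0\ \text{ as }|(r,z)|\to\infty . \] Set $\Psi=\psi-\frac W2r^2$ and \[ R=\frac1{|E|}\int_E r\,\mathrm d(r,z),\quad \delta=\int_E\frac1{r^2}\,\mathrm d(r,z)-2\pi,\quad \beta=-\int_{\partial E}\frac1r\partial_n\psi\,\mathrm ds,\quad \mathrm{We}=\frac{\sqrt{2\pi}\,\rho\beta^2}{\sigma\sqrt{|E|}}, \] where $|E|$ is the area of $E$. Then there exists a constant $C>0$, independent of $\sigma$, $\rho$ and the solution, such that for any solution $(E,\psi,W,\gamma,\lambda)$ that satisfies $\partial_n\Psi\le0$ on $\partial E$ and $2\pi R^2\le|E|$, one has \[ \mathrm{We}\ge C(1+\delta). \] -/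

import Mathlib

open Set Filter Topology MeasureTheory

namespace BubbleRing

noncomputable section

/-- The open meridional half plane of points `(r, z)` with `r > 0`. -/
def halfPlane : Set (ℝ × ℝ) := {p | 0 < p.1}

/-- The cross-sections under consideration: bounded convex sets with nonempty interior, symmetric
in `z`, with closure inside the open half plane, so that rotation about the axis `r = 0` yields a
torus. -/
structure IsCrossSection (E : Set (ℝ × ℝ)) : Prop where
  convex : Convex ℝ E
  bounded : Bornology.IsBounded E
  interior_nonempty : (interior E).Nonempty
  closure_subset : closure E ⊆ halfPlane
  symmetric : ∀ r z : ℝ, (r, z) ∈ E → (r, -z) ∈ E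

/-- Unit normal `(z', -r')` of an arclength parametrised plane curve `c = (r, z)`. -/
def normal (c : ℝ → ℝ × ℝ) (s : ℝ) : ℝ × ℝ := ((deriv c s).2, -(deriv c s).1)

/-- Signed curvature `r' z'' - z' r''` of an arclength parametrised plane curve `c = (r, z)`.
It is positive on convex arcs when `normal c` is the outer normal. -/
def curvature (c : ℝ → ℝ × ℝ) (s : ℝ) : ℝ :=
  (deriv c s).1 * (deriv (deriv c) s).2 - (deriv c s).2 * (deriv (deriv c) s).1

/-- `c` is a simple closed `C²` parametrisation by arclength, with period `L` (the perimeter), of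
the boundary of `E`, oriented so that `normal c` points into the exterior of `E`. -/
structure IsBoundaryCurve (E : Set (ℝ × ℝ)) (L : ℝ) (c : ℝ → ℝ × ℝ) : Prop where
  length_pos : 0 < L
  contDiff : ContDiff ℝ 2 c
  periodic : Function.Periodic c L
  injOn : InjOn c (Ico 0 L)
  range_eq : range c = frontier E
  unit_speed : ∀ s, (deriv c s).1 ^ 2 + (deriv c s).2 ^ 2 = 1
  normal_outward : ∀ s, ∀ᶠ t : ℝ in 𝓝[>] 0, c s + t • normal c s ∉ closure E

/-- `H = κ + (n · e_r) / r` (twice the mean curvature of the torus) at the boundary point `c s`. -/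
def meanCurvature (c : ℝ → ℝ × ℝ) (s : ℝ) : ℝ :=
  curvature c s + (normal c s).1 / (c s).1

/-- Normal derivative `∂ₙ f` at the boundary point `c s`, taken from the exterior. -/
def normalDeriv (c : ℝ → ℝ × ℝ) (f : ℝ × ℝ → ℝ) (s : ℝ) : ℝ :=
  derivWithin (fun t : ℝ => f (c s + t • normal c s)) (Ici 0) 0

/-- Partial derivative in `r`. -/
def partialR (f : ℝ × ℝ → ℝ) (p : ℝ × ℝ) : ℝ := fderiv ℝ f p (1, 0)

/-- Partial derivative in `z`. -/
def partialZ (f : ℝ × ℝ → ℝ) (p : ℝ × ℝ) : ℝ := fderiv ℝ f p (0, 1)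

/-- `div (r⁻¹ ∇ f)` with the gradient and the divergence taken in the variables `(r, z)`. -/
def divGrad (f : ℝ × ℝ → ℝ) (p : ℝ × ℝ) : ℝ :=
  partialR (fun q => 1 / q.1 * partialR f q) p + partialZ (fun q => 1 / q.1 * partialZ f q) p

/-- The stream function in the moving frame, `Ψ = ψ - W r² / 2`. -/
def movingStream (ψ : ℝ × ℝ → ℝ) (W : ℝ) (p : ℝ × ℝ) : ℝ := ψ p - W / 2 * p.1 ^ 2

/-- `(E, ψ, W, γ, lam)` is a classical solution of the steady free-boundary capillary Euler equations
with surface tension `σ` and density `ρ`; the boundary of `E` is parametrised by `c` with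
period `L`. -/
structure IsSolution (σ ρ : ℝ) (E : Set (ℝ × ℝ)) (L : ℝ) (c : ℝ → ℝ × ℝ)
    (ψ : ℝ × ℝ → ℝ) (W γ lam : ℝ) : Prop where
  crossSection : IsCrossSection E
  boundary : IsBoundaryCurve E L c
  contDiffOn : ContDiffOn ℝ 2 ψ (halfPlane \ closure E)
  continuousOn : ContinuousOn ψ (closure halfPlane \ interior E)
  normal_differentiable : ∀ s,
    DifferentiableWithinAt ℝ (fun t : ℝ => ψ (c s + t • normal c s)) (Ici 0) 0
  irrotational : ∀ p ∈ halfPlane \ closure E, -divGrad ψ p = 0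
  flux : ∀ p ∈ frontier E, ψ p - W / 2 * p.1 ^ 2 = γ
  jump : ∀ s, 2 * σ * meanCurvature c s
    - ρ * (1 / (c s).1 * normalDeriv c ψ s - W * (normal c s).1) ^ 2 + lam = 0
  axis : ∀ p ∈ frontier halfPlane, ψ p = 0
  decay : Tendsto ψ (cocompact (ℝ × ℝ) ⊓ 𝓟 halfPlane) (𝓝 0)

/-- The area of the cross-section. -/
def area (E : Set (ℝ × ℝ)) : ℝ := (volume : Measure (ℝ × ℝ)).real E

/-- The major radius, the mean of `r` over the cross-section. -/
def majorRadius (E : Set (ℝ × ℝ)) : ℝ := 1 / area E * ∫ p in E, p.1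

/-- The thickness measure `δ = ∫_E r⁻² - 2π`. -/
def thickness (E : Set (ℝ × ℝ)) : ℝ := (∫ p in E, 1 / p.1 ^ 2) - 2 * Real.pi

/-- The circulation `β = -∫_{∂E} r⁻¹ ∂ₙψ ds`. -/
def circulation (L : ℝ) (c : ℝ → ℝ × ℝ) (ψ : ℝ × ℝ → ℝ) : ℝ :=
  -∫ s in (0 : ℝ)..L, 1 / (c s).1 * normalDeriv c ψ s

/-- The Weber number `√(2π) ρ β² / (σ √|E|)`. -/
def weber (σ ρ : ℝ) (E : Set (ℝ × ℝ)) (L : ℝ) (c : ℝ → ℝ × ℝ) (ψ : ℝ × ℝ → ℝ) : ℝ :=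
  Real.sqrt (2 * Real.pi) * ρ * circulation L c ψ ^ 2 / (σ * Real.sqrt (area E))

end

end BubbleRing

/-!
The potential equation plays no role: the bound comes from the free boundary condition and from the
geometry of the cross-section.

Write `u = r⁻¹ ∂ₙΨ ≤ 0`, so that `ρ u² = 2σH + lam` on the boundary. If `H = -M` at one boundary point,
then `lam ≥ 2σM`. As `E` is convex, `κ ≥ 0`, so `H ≥ 0` wherever the normal satisfies `n_r ≥ 0`, and
there `ρ u² ≥ 2σM`. The set where `n_r ≥ 0` has length at least the height `h` of `E`, and `W n_r`
integrates to zero, so `β = -∫ u ≥ h √(2σM/ρ)` (`IsSolution.circulation_ge`).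

It remains to find a point with large `M`. On the inner arc, where the curve runs from a highest to a
lowest point of `E` with `n_r < 0`, one has `-n_r / r = κ - H`. Integrating `r⁻²` over `E` first in `r`
gives `∫_E r⁻² ≤ ∫ -n_r / r ds` (`IsBoundaryCurve.integral_inv_sq_le`), and the integral of `κ` over the
inner arc is at most `π` (`IsBoundaryCurve.integral_curvature_le`). Hence
`2π + δ ≤ π + M · length`, where `M` is the maximum of `-H` on the arc. By Jensen's inequality the
assumption `2πR² ≤ |E|` gives `δ ≥ 0`, so `M · length ≥ 1 + δ > 0`. The same assumption bounds the
largest radius, and with it the length of the inner arc and `√|E|`, by multiples of `h`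
(`IsBoundaryCurve.exists_meanCurvature_le`). Altogether `We` is bounded below by a multiple of
`M h² / √|E|`, and so of `1 + δ`.
-/

namespace BubbleRing

/-! ### Regularity and support lines of the boundary curve -/

namespace IsBoundaryCurve

variable {E : Set (ℝ × ℝ)} {L : ℝ} {c : ℝ → ℝ × ℝ}

theorem hasDerivAt (hc : IsBoundaryCurve E L c) (s : ℝ) : HasDerivAt c (deriv c s) s :=
  ((hc.contDiff.differentiable (by norm_num)) s).hasDerivAt

theorem contDiff_deriv (hc : IsBoundaryCurve E L c) : ContDiff ℝ 1 (deriv c) :=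
  (contDiff_succ_iff_deriv.1 (show ContDiff ℝ (1 + 1) c from hc.contDiff)).2.2

theorem hasDerivAt_deriv (hc : IsBoundaryCurve E L c) (s : ℝ) :
    HasDerivAt (deriv c) (deriv (deriv c) s) s :=
  ((hc.contDiff_deriv.differentiable (by norm_num)) s).hasDerivAt

theorem hasDerivAt_fst (hc : IsBoundaryCurve E L c) (s : ℝ) :
    HasDerivAt (fun t => (c t).1) (deriv c s).1 s :=
  (ContinuousLinearMap.fst ℝ ℝ ℝ).hasFDerivAt.comp_hasDerivAt s (hc.hasDerivAt s)

theorem hasDerivAt_snd (hc : IsBoundaryCurve E L c) (s : ℝ) :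
    HasDerivAt (fun t => (c t).2) (deriv c s).2 s :=
  (ContinuousLinearMap.snd ℝ ℝ ℝ).hasFDerivAt.comp_hasDerivAt s (hc.hasDerivAt s)

theorem hasDerivAt_deriv_fst (hc : IsBoundaryCurve E L c) (s : ℝ) :
    HasDerivAt (fun t => (deriv c t).1) (deriv (deriv c) s).1 s :=
  (ContinuousLinearMap.fst ℝ ℝ ℝ).hasFDerivAt.comp_hasDerivAt s (hc.hasDerivAt_deriv s)

theorem hasDerivAt_deriv_snd (hc : IsBoundaryCurve E L c) (s : ℝ) :
    HasDerivAt (fun t => (deriv c t).2) (deriv (deriv c) s).2 s :=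
  (ContinuousLinearMap.snd ℝ ℝ ℝ).hasFDerivAt.comp_hasDerivAt s (hc.hasDerivAt_deriv s)

theorem continuous_curve (hc : IsBoundaryCurve E L c) : Continuous c := hc.contDiff.continuous

theorem continuous_deriv (hc : IsBoundaryCurve E L c) : Continuous (deriv c) :=
  hc.contDiff_deriv.continuous

theorem continuous_deriv_deriv (hc : IsBoundaryCurve E L c) : Continuous (deriv (deriv c)) :=
  (contDiff_one_iff_deriv.1 hc.contDiff_deriv).2

theorem continuous_normal (hc : IsBoundaryCurve E L c) : Continuous (normal c) := by
  have := hc.continuous_deriv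
  unfold normal
  fun_prop

theorem continuous_curvature (hc : IsBoundaryCurve E L c) : Continuous (curvature c) := by
  have := hc.continuous_deriv
  have := hc.continuous_deriv_deriv
  unfold curvature
  fun_prop

theorem mem_frontier (hc : IsBoundaryCurve E L c) (s : ℝ) : c s ∈ frontier E :=
  hc.range_eq ▸ mem_range_self s

theorem mem_closure (hc : IsBoundaryCurve E L c) (s : ℝ) : c s ∈ closure E :=
  frontier_subset_closure (hc.mem_frontier s)

theorem fst_pos (hE : IsCrossSection E) (hc : IsBoundaryCurve E L c) (s : ℝ) : 0 < (c s).1 :=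
  hE.closure_subset (hc.mem_closure s)

theorem continuous_meanCurvature (hE : IsCrossSection E) (hc : IsBoundaryCurve E L c) :
    Continuous (meanCurvature c) := by
  have h1 := hc.continuous_curvature
  have h2 := hc.continuous_normal
  have h3 := hc.continuous_curve
  unfold meanCurvature
  exact h1.add (h2.fst.div h3.fst fun s => (hc.fst_pos hE s).ne')

theorem periodic_deriv (hc : IsBoundaryCurve E L c) : Function.Periodic (deriv c) L := by
  intro s
  have h : (fun t => c (t + L)) = c := funext hc.periodic
  rw [← deriv_comp_add_const, h]

theorem periodic_normal (hc : IsBoundaryCurve E L c) : Function.Periodic (normal c) L := by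
  intro s
  simp only [normal, hc.periodic_deriv s]

/-- Frenet equation for the tangent, first component. -/
theorem deriv_deriv_fst (hc : IsBoundaryCurve E L c) (s : ℝ) :
    (deriv (deriv c) s).1 = -curvature c s * (deriv c s).2 := by
  have h := ((hc.hasDerivAt_deriv_fst s).pow 2).add ((hc.hasDerivAt_deriv_snd s).pow 2)
  have h0 := h.unique (((hasDerivAt_const s (1 : ℝ))).congr_of_eventuallyEq
    (Eventually.of_forall fun t => by simpa using hc.unit_speed t))
  have h1 := hc.unit_speed s
  simp only [curvature]
  norm_num at h0
  linear_combination (-(deriv (deriv c) s).1) * h1 + (deriv c s).1 / 2 * h0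

/-- Frenet equation for the tangent, second component. -/
theorem deriv_deriv_snd (hc : IsBoundaryCurve E L c) (s : ℝ) :
    (deriv (deriv c) s).2 = curvature c s * (deriv c s).1 := by
  have h := ((hc.hasDerivAt_deriv_fst s).pow 2).add ((hc.hasDerivAt_deriv_snd s).pow 2)
  have h0 := h.unique (((hasDerivAt_const s (1 : ℝ))).congr_of_eventuallyEq
    (Eventually.of_forall fun t => by simpa using hc.unit_speed t))
  have h1 := hc.unit_speed s
  simp only [curvature]
  norm_num at h0
  linear_combination (-(deriv (deriv c) s).2) * h1 + (deriv c s).2 / 2 * h0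

/-- The line through a boundary point orthogonal to the normal supports `E`, on the side opposite to
the normal. A support line must be tangent to the curve; if `E` lay on the side of the normal, it
would contain a short piece of the normal ray, as the cone spanned at the boundary point by an
interior point of `E` and the chords of the curve contains the normal. -/
theorem support (hE : IsCrossSection E) (hc : IsBoundaryCurve E L c) (s : ℝ) {x : ℝ × ℝ}
    (hx : x ∈ closure E) :
    (normal c s).1 * (x.1 - (c s).1) + (normal c s).2 * (x.2 - (c s).2) ≤ 0 := by
  obtain ⟨f, hf⟩ := geometric_hahn_banach_open_point hE.convex.interior isOpen_interior
    (hc.mem_frontier s).2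
  have hf' : ∀ y ∈ closure E, f y ≤ f (c s) := by
    intro y hy
    rw [← hE.convex.closure_interior_eq_closure_of_nonempty_interior hE.interior_nonempty] at hy
    exact closure_minimal (fun y hy => (hf y hy).le)
      (isClosed_le f.continuous continuous_const) hy
  have hlin : ∀ y : ℝ × ℝ, f y = f (1, 0) * y.1 + f (0, 1) * y.2 := by
    intro y
    have : y = y.1 • ((1 : ℝ), (0 : ℝ)) + y.2 • ((0 : ℝ), (1 : ℝ)) := by ext <;> simp
    conv_lhs => rw [this]
    rw [map_add, map_smul, map_smul]
    simp [mul_comm]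
  set v₁ := f (1, 0)
  set v₂ := f (0, 1)
  have htan : f (deriv c s) = 0 := by
    have hmax : IsLocalMax (fun t => f (c t)) s :=
      Eventually.of_forall fun t => hf' _ (hc.mem_closure t)
    exact hmax.hasDerivAt_eq_zero (f.hasFDerivAt.comp_hasDerivAt s (hc.hasDerivAt s))
  rw [hlin] at htan
  have hu := hc.unit_speed s
  have key : ∀ y : ℝ × ℝ, f y - f (c s) = (v₁ * (deriv c s).2 - v₂ * (deriv c s).1) *
      ((normal c s).1 * (y.1 - (c s).1) + (normal c s).2 * (y.2 - (c s).2)) := by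
    intro y
    rw [hlin y, hlin (c s)]
    simp only [normal]
    linear_combination (-(v₁ * (y.1 - (c s).1) + v₂ * (y.2 - (c s).2))) * hu +
      ((deriv c s).1 * (y.1 - (c s).1) + (deriv c s).2 * (y.2 - (c s).2)) * htan
  set μ := v₁ * (deriv c s).2 - v₂ * (deriv c s).1
  obtain ⟨q, hq⟩ := hE.interior_nonempty
  have hqlt := hf q hq
  have hkq := key q
  rcases lt_or_ge 0 μ with hμ | hμ
  · have h1 := key x
    have h2 := hf' x hx
    by_contra hcon
    push Not at hcon
    nlinarith [mul_pos hμ hcon]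
  · exfalso
    set B := (normal c s).1 * (q.1 - (c s).1) + (normal c s).2 * (q.2 - (c s).2) with hB
    set A := (deriv c s).1 * (q.1 - (c s).1) + (deriv c s).2 * (q.2 - (c s).2) with hA
    have hBpos : 0 < B := by
      by_contra hcon
      push Not at hcon
      nlinarith [mul_nonneg_of_nonpos_of_nonpos hμ hcon]
    -- `q - c s = A τ + B n`, so `n = (q - c s) / B + k τ`, and `k τ` is a limit of chords
    set k := -A / B with hk
    have hder : HasDerivAt (fun e : ℝ => c (s + e * k)) (k • deriv c s) 0 := by
      have h1 : HasDerivAt (fun e : ℝ => s + e * k) k 0 := by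
        simpa using ((hasDerivAt_id (0 : ℝ)).mul_const k).const_add s
      have h2 : HasDerivAt c (deriv c s) (s + 0 * k) := by simpa using hc.hasDerivAt s
      exact h2.scomp (0 : ℝ) h1
    have htend : Tendsto (fun e : ℝ => c s + B • (normal c s - e⁻¹ • (c (s + e * k) - c s)))
        (𝓝[>] 0) (𝓝 q) := by
      have h1 : Tendsto (fun e : ℝ => e⁻¹ • (c (s + e * k) - c s)) (𝓝[>] 0)
          (𝓝 (k • deriv c s)) := by
        have := hder.tendsto_slope_zero_right
        simpa using this
      have h2 := ((h1.const_sub (normal c s)).const_smul B).const_add (c s)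
      convert h2 using 2
      have hk' : B * k = -A := by rw [hk]; field_simp
      ext
      · simp only [Prod.fst_add, Prod.smul_fst, Prod.fst_sub, smul_eq_mul]
        have e1 : (normal c s).1 = (deriv c s).2 := rfl
        have e2 : (normal c s).2 = -(deriv c s).1 := rfl
        rw [e1, e2] at hB
        rw [e1]
        linear_combination (-(q.1 - (c s).1)) * hu - (deriv c s).2 * hB - (deriv c s).1 * hA
          + (deriv c s).1 * hk'
      · simp only [Prod.snd_add, Prod.smul_snd, Prod.snd_sub, smul_eq_mul]
        have e1 : (normal c s).1 = (deriv c s).2 := rfl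
        have e2 : (normal c s).2 = -(deriv c s).1 := rfl
        rw [e1, e2] at hB
        rw [e2]
        linear_combination (-(q.2 - (c s).2)) * hu + (deriv c s).1 * hB - (deriv c s).2 * hA
          + (deriv c s).2 * hk'
    obtain ⟨e, he, hepos⟩ := ((htend.eventually (isOpen_interior.mem_nhds hq)).and
      self_mem_nhdsWithin).exists
    have hepos : 0 < e := hepos
    have hconv : Convex ℝ (closure E) := hE.convex.closure
    have hmem : c s + (B * e / (B + e)) • normal c s ∈ closure E := by
      have h1 : c s + B • (normal c s - e⁻¹ • (c (s + e * k) - c s)) ∈ closure E :=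
        subset_closure (interior_subset he)
      have h2 := hconv h1 (hc.mem_closure (s + e * k)) (a := e / (B + e)) (b := B / (B + e))
        (by positivity) (by positivity) (by field_simp; ring)
      convert h2 using 1
      ext
      · simp; field_simp; ring
      · simp; field_simp; ring
    set T := B * e / (B + e)
    have hT : 0 < T := by positivity
    have hlt : ∀ᶠ t : ℝ in 𝓝[>] 0, t < T :=
      (eventually_lt_nhds hT).filter_mono nhdsWithin_le_nhds
    obtain ⟨t, ⟨ht1, ht2⟩, ht0⟩ := ((hc.normal_outward s).and hlt |>.and
      self_mem_nhdsWithin).exists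
    have ht0 : 0 < t := ht0
    apply ht1
    have h3 := hconv (hc.mem_closure s) hmem (a := 1 - t / T) (b := t / T)
      (sub_nonneg.2 ((div_le_one hT).2 ht2.le)) (by positivity) (by ring)
    convert h3 using 1
    ext
    · simp; field_simp; ring
    · simp; field_simp; ring

theorem curvature_nonneg (hE : IsCrossSection E) (hc : IsBoundaryCurve E L c) (s : ℝ) :
    0 ≤ curvature c s := by
  -- adding the support inequalities at `s` and `t` shows that the increments of `c` and of its
  -- normal have nonnegative inner product
  have h1 := hasDerivAt_iff_tendsto_slope.1 (hc.hasDerivAt_fst s)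
  have h2 := hasDerivAt_iff_tendsto_slope.1 (hc.hasDerivAt_snd s)
  have h3 := hasDerivAt_iff_tendsto_slope.1 (hc.hasDerivAt_deriv_fst s)
  have h4 := hasDerivAt_iff_tendsto_slope.1 (hc.hasDerivAt_deriv_snd s)
  have h := (h1.mul h4).sub (h2.mul h3)
  refine ge_of_tendsto h (eventually_nhdsWithin_of_forall fun t ht => ?_)
  have hts : t - s ≠ 0 := sub_ne_zero.2 ht
  have a1 := hc.support hE s (hc.mem_closure t)
  have a2 := hc.support hE t (hc.mem_closure s)
  simp only [normal] at a1 a2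
  simp only [slope_def_field]
  rw [div_mul_div_comm, div_mul_div_comm, ← sub_div]
  apply div_nonneg _ (mul_self_nonneg _)
  linarith

/-- Where the outer normal is not directed towards the axis, the mean curvature is nonnegative. -/
theorem meanCurvature_nonneg (hE : IsCrossSection E) (hc : IsBoundaryCurve E L c) {s : ℝ}
    (hs : 0 ≤ (normal c s).1) : 0 ≤ meanCurvature c s :=
  add_nonneg (hc.curvature_nonneg hE s) (div_nonneg hs (hc.fst_pos hE s).le)

end IsBoundaryCurve

/-! ### Extreme points and the inner arc -/

theorem not_isMaxOn_of_mem_interior {K : Set (ℝ × ℝ)} {f : ℝ × ℝ →L[ℝ] ℝ} (hf : f ≠ 0)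
    {q : ℝ × ℝ} (hq : q ∈ interior K) : ¬ IsMaxOn f K q := by
  intro h
  have h1 : IsLocalMax f q := h.isLocalMax (mem_interior_iff_mem_nhds.1 hq)
  exact hf (h1.hasFDerivAt_eq_zero f.hasFDerivAt)

theorem fst_ne_zero : ContinuousLinearMap.fst ℝ ℝ ℝ ≠ 0 := fun h => by
  simpa using DFunLike.congr_fun h (1, 0)

theorem snd_ne_zero : ContinuousLinearMap.snd ℝ ℝ ℝ ≠ 0 := fun h => by
  simpa using DFunLike.congr_fun h (0, 1)

theorem IsCrossSection.isCompact_closure {E : Set (ℝ × ℝ)} (hE : IsCrossSection E) :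
    IsCompact (closure E) := hE.bounded.isCompact_closure

namespace IsBoundaryCurve

variable {E : Set (ℝ × ℝ)} {L : ℝ} {c : ℝ → ℝ × ℝ}

theorem exists_isMaxOn (hE : IsCrossSection E) (hc : IsBoundaryCurve E L c)
    {f : ℝ × ℝ →L[ℝ] ℝ} (hf : f ≠ 0) : ∃ s, ∀ x ∈ closure E, f x ≤ f (c s) := by
  obtain ⟨x, hx, hmax⟩ := hE.isCompact_closure.exists_isMaxOn
    (hE.interior_nonempty.mono (interior_subset.trans subset_closure)) f.continuous.continuousOn
  have hx' : x ∈ frontier E :=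
    ⟨hx, fun h => not_isMaxOn_of_mem_interior hf (interior_mono subset_closure h) hmax⟩
  rw [← hc.range_eq] at hx'
  obtain ⟨s, rfl⟩ := hx'
  exact ⟨s, hmax⟩

/-- A point of the curve with horizontal tangent is a highest or a lowest point of `E`. -/
theorem extreme_of_deriv_snd_eq_zero (hE : IsCrossSection E) (hc : IsBoundaryCurve E L c) {s : ℝ}
    (hs : (deriv c s).2 = 0) :
    (∀ x ∈ closure E, x.2 ≤ (c s).2) ∨ (∀ x ∈ closure E, (c s).2 ≤ x.2) := by
  have hu := hc.unit_speed s
  have hsup := fun x hx => hc.support hE s (x := x) hx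
  simp only [normal, hs] at hsup
  rw [hs] at hu
  rcases lt_or_ge 0 (deriv c s).1 with h | h
  · right
    intro x hx
    nlinarith [hsup x hx]
  · left
    intro x hx
    have : (deriv c s).1 < 0 := lt_of_le_of_ne h (by rintro h0; rw [h0] at hu; norm_num at hu)
    nlinarith [hsup x hx]

/-- The inner arc of the curve: on `(a, b)` the height decreases strictly, from its largest to its
smallest value over `E`. -/
structure IsInnerArc (E : Set (ℝ × ℝ)) (c : ℝ → ℝ × ℝ) (a b : ℝ) : Prop where
  lt : a < b
  le_top : ∀ x ∈ closure E, x.2 ≤ (c a).2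
  bot_le : ∀ x ∈ closure E, (c b).2 ≤ x.2
  bot_lt_top : (c b).2 < (c a).2
  deriv_neg : ∀ s ∈ Ioo a b, (deriv c s).2 < 0

/-- The inner arc runs from the last highest point before the first lowest point: between these two
the tangent is never horizontal. -/
theorem exists_isInnerArc (hE : IsCrossSection E) (hc : IsBoundaryCurve E L c) :
    ∃ a b, IsInnerArc E c a b := by
  obtain ⟨a₀, ha₀⟩ := hc.exists_isMaxOn hE snd_ne_zero
  obtain ⟨b₀, hb₀⟩ := hc.exists_isMaxOn hE (neg_ne_zero.2 snd_ne_zero)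
  simp only [ContinuousLinearMap.coe_snd', neg_apply, neg_le_neg_iff]
    at ha₀ hb₀
  have hlt : (c b₀).2 < (c a₀).2 := by
    obtain ⟨q, hq⟩ := hE.interior_nonempty
    by_contra hcon
    push Not at hcon
    have hq' := subset_closure (interior_subset hq)
    refine not_isMaxOn_of_mem_interior snd_ne_zero hq fun x hx => ?_
    exact ((ha₀ x (subset_closure hx)).trans hcon).trans (hb₀ q hq')
  obtain ⟨n, hn⟩ := Archimedean.arch (a₀ - b₀) hc.length_pos
  set b₁ := b₀ + n • L with hb₁
  have hcb₁ : c b₁ = c b₀ := (hc.periodic.nsmul n) b₀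
  have hab₁ : a₀ ≤ b₁ := by linarith
  have hcont : Continuous fun s => (c s).2 := hc.continuous_curve.snd
  have hS : IsCompact (Icc a₀ b₁ ∩ {s | (c s).2 = (c b₀).2}) :=
    isCompact_Icc.inter_right (isClosed_eq hcont continuous_const)
  obtain ⟨b, ⟨⟨hb1, hb2⟩, hb3⟩, hbleast⟩ := hS.exists_isLeast
    ⟨b₁, ⟨hab₁, le_rfl⟩, congrArg Prod.snd hcb₁⟩
  have hT : IsCompact (Icc a₀ b ∩ {s | (c s).2 = (c a₀).2}) :=
    isCompact_Icc.inter_right (isClosed_eq hcont continuous_const)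
  obtain ⟨a, ⟨⟨ha1, ha2⟩, ha3⟩, hagreatest⟩ := hT.exists_isGreatest ⟨a₀, ⟨le_rfl, hb1⟩, rfl⟩
  rw [mem_ofPred_eq] at hb3 ha3
  have hab : a < b := lt_of_le_of_ne ha2 fun h => by rw [h, hb3] at ha3; exact hlt.ne ha3
  have hne : ∀ s ∈ Ioo a b, (deriv c s).2 ≠ 0 := by
    intro s hs h0
    rcases hc.extreme_of_deriv_snd_eq_zero hE h0 with h | h
    · have : (c s).2 = (c a₀).2 := le_antisymm (ha₀ _ (hc.mem_closure s)) (h _ (hc.mem_closure a₀))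
      exact absurd (hagreatest ⟨⟨ha1.trans hs.1.le, hs.2.le⟩, this⟩) (not_le.2 hs.1)
    · have : (c s).2 = (c b₀).2 := le_antisymm (h _ (hc.mem_closure b₀)) (hb₀ _ (hc.mem_closure s))
      exact absurd (hbleast ⟨⟨ha1.trans hs.1.le, hs.2.le.trans hb2⟩, this⟩) (not_le.2 hs.2)
  refine ⟨a, b, hab, ?_, ?_, ?_, ?_⟩
  · rwa [ha3]
  · rwa [hb3]
  · rwa [ha3, hb3]
  · obtain ⟨ξ, hξ, hξ'⟩ := exists_hasDerivAt_eq_slope (fun s => (c s).2) (fun s => (deriv c s).2)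
      hab hcont.continuousOn fun s _ => hc.hasDerivAt_snd s
    have hneg : (deriv c ξ).2 < 0 := by
      rw [hξ']
      exact div_neg_of_neg_of_pos (by rw [ha3, hb3]; linarith) (by linarith)
    rcases hasDerivWithinAt_forall_lt_or_forall_gt_of_forall_ne (convex_Ioo a b)
      (fun s _ => (hc.hasDerivAt_snd s).hasDerivWithinAt) hne with h | h
    · exact h
    · exact absurd (h ξ hξ) (not_lt.2 hneg.le)

/-- The tangent turns by at most a half turn along the inner arc: `arctan (-r' / z')` is an
antiderivative of the curvature. -/
theorem integral_curvature_le (hc : IsBoundaryCurve E L c) {a b : ℝ} (h : IsInnerArc E c a b) :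
    ∫ s in a..b, curvature c s ≤ Real.pi := by
  have hcurv := hc.continuous_curvature
  have hint : ∀ x y, IntervalIntegrable (curvature c) volume x y :=
    fun x y => hcurv.intervalIntegrable x y
  have hsub : ∀ a' b', a < a' → a' ≤ b' → b' < b → ∫ s in a'..b', curvature c s ≤ Real.pi := by
    intro a' b' h1 h2 h3
    have hd : ∀ s ∈ uIcc a' b', HasDerivAt
        (fun t => Real.arctan (-(deriv c t).1 / (deriv c t).2)) (curvature c s) s := by
      intro s hs
      rw [uIcc_of_le h2] at hs
      have hz := h.deriv_neg s ⟨h1.trans_le hs.1, hs.2.trans_lt h3⟩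
      have hu := hc.unit_speed s
      refine ((hc.hasDerivAt_deriv_fst s).neg.div
        (hc.hasDerivAt_deriv_snd s) hz.ne).arctan.congr_deriv ?_
      have hz2 : (deriv c s).2 ^ 2 ≠ 0 := pow_ne_zero _ hz.ne
      have hsec : 1 + (-(deriv c s).1 / (deriv c s).2) ^ 2 = 1 / (deriv c s).2 ^ 2 := by
        rw [div_pow, neg_sq, eq_div_iff hz2, add_mul, div_mul_cancel₀ _ hz2]
        linarith
      simp only [Pi.neg_apply, Pi.div_apply]
      rw [hsec]
      simp only [curvature]
      have hz1 := hz.ne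
      field_simp
      ring
    rw [intervalIntegral.integral_eq_sub_of_hasDerivAt hd (hint _ _)]
    have p1 := Real.arctan_lt_pi_div_two (-(deriv c b').1 / (deriv c b').2)
    have p2 := Real.neg_pi_div_two_lt_arctan (-(deriv c a').1 / (deriv c a').2)
    linarith
  have hG : Continuous fun x => ∫ s in (0 : ℝ)..x, curvature c s :=
    intervalIntegral.continuous_primitive hint 0
  have htend : Tendsto (fun e : ℝ => (∫ s in (0 : ℝ)..(b - e), curvature c s) -
      ∫ s in (0 : ℝ)..(a + e), curvature c s) (𝓝[>] 0) (𝓝 (∫ s in a..b, curvature c s)) := by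
    have h1 : Continuous fun e : ℝ => (∫ s in (0 : ℝ)..(b - e), curvature c s) -
      ∫ s in (0 : ℝ)..(a + e), curvature c s :=
      (hG.comp (continuous_const.sub continuous_id)).sub
        (hG.comp (continuous_const.add continuous_id))
    have h2 := (h1.tendsto 0).mono_left (nhdsWithin_le_nhds (s := Ioi 0))
    simpa [intervalIntegral.integral_interval_sub_left (hint 0 b) (hint 0 a)] using h2
  refine le_of_tendsto htend ?_
  have hsm : ∀ᶠ e : ℝ in 𝓝[>] 0, e < (b - a) / 2 :=
    (eventually_lt_nhds (by linarith [h.lt])).filter_mono nhdsWithin_le_nhds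
  filter_upwards [hsm, self_mem_nhdsWithin] with e he he0
  have he0 : 0 < e := he0
  rw [intervalIntegral.integral_interval_sub_left (hint _ _) (hint _ _)]
  exact hsub _ _ (by linarith) (by linarith) (by linarith)

/-- The length of the inner arc is at most `(1 + π) D` if `c - c a` has size at most `D`, because
`⟨c - c a, τ⟩' = 1 - κ ⟨c - c a, n⟩`. -/
theorem innerArc_length_le (hE : IsCrossSection E) (hc : IsBoundaryCurve E L c) {a b : ℝ}
    (h : IsInnerArc E c a b) {D : ℝ}
    (hD : ∀ s, |(c s).1 - (c a).1| + |(c s).2 - (c a).2| ≤ D) :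
    b - a ≤ (1 + Real.pi) * D := by
  have hprod : ∀ s (u v : ℝ), u ^ 2 + v ^ 2 = 1 →
      ((c s).1 - (c a).1) * u + ((c s).2 - (c a).2) * v ≤ D := by
    intro s u v huv
    have hu : |u| ≤ 1 := abs_le_one_iff_mul_self_le_one.2 (by nlinarith [sq_nonneg v])
    have hv : |v| ≤ 1 := abs_le_one_iff_mul_self_le_one.2 (by nlinarith [sq_nonneg u])
    calc _ ≤ |(c s).1 - (c a).1| * |u| + |(c s).2 - (c a).2| * |v| := by
          rw [← abs_mul, ← abs_mul]; exact add_le_add (le_abs_self _) (le_abs_self _)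
      _ ≤ |(c s).1 - (c a).1| * 1 + |(c s).2 - (c a).2| * 1 := by gcongr
      _ ≤ D := by simpa using hD s
  have hd : ∀ s ∈ uIcc a b, HasDerivAt
      (fun t => ((c t).1 - (c a).1) * (deriv c t).1 + ((c t).2 - (c a).2) * (deriv c t).2)
      (1 - curvature c s * (((c s).1 - (c a).1) * (normal c s).1 +
        ((c s).2 - (c a).2) * (normal c s).2)) s := by
    intro s _
    refine ((((hc.hasDerivAt_fst s).sub_const (c a).1).mul (hc.hasDerivAt_deriv_fst s)).add
      (((hc.hasDerivAt_snd s).sub_const (c a).2).mul (hc.hasDerivAt_deriv_snd s))).congr_deriv ?_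
    rw [hc.deriv_deriv_fst s, hc.deriv_deriv_snd s]
    simp only [normal]
    linear_combination hc.unit_speed s
  have hcurv := hc.continuous_curvature
  have hcc := hc.continuous_curve
  have hn := hc.continuous_normal
  have hκ : IntervalIntegrable (fun s => curvature c s * D) volume a b :=
    (hcurv.mul continuous_const).intervalIntegrable _ _
  have hint : IntervalIntegrable (fun s => 1 - curvature c s * (((c s).1 - (c a).1) *
      (normal c s).1 + ((c s).2 - (c a).2) * (normal c s).2)) volume a b :=
    (continuous_const.sub (hcurv.mul (((hcc.fst.sub continuous_const).mul hn.fst).add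
      ((hcc.snd.sub continuous_const).mul hn.snd)))).intervalIntegrable _ _
  have hF := intervalIntegral.integral_eq_sub_of_hasDerivAt hd hint
  simp only [sub_self, zero_mul, add_zero, sub_zero] at hF
  have hend := hprod b _ _ (hc.unit_speed b)
  have hD0 : 0 ≤ D := (by positivity : (0 : ℝ) ≤ _).trans (hD a)
  have hmono : ∫ s in a..b, (1 - curvature c s * D) ≤ ∫ s in a..b, (1 - curvature c s *
      (((c s).1 - (c a).1) * (normal c s).1 + ((c s).2 - (c a).2) * (normal c s).2)) := by
    refine intervalIntegral.integral_mono_on h.lt.le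
      ((continuous_const.sub (hcurv.mul continuous_const)).intervalIntegrable _ _) hint fun s _ => ?_
    refine sub_le_sub_left (mul_le_mul_of_nonneg_left ?_ (hc.curvature_nonneg hE s)) 1
    refine hprod s _ _ ?_
    simp only [normal]
    linarith [hc.unit_speed s]
  rw [hF, intervalIntegral.integral_sub intervalIntegrable_const hκ,
    intervalIntegral.integral_mul_const] at hmono
  simp only [intervalIntegral.integral_const, smul_eq_mul, mul_one] at hmono
  have := mul_le_mul_of_nonneg_right (hc.integral_curvature_le h) hD0
  linarith

/-- The integral of the positive part of `n_r = z'` over a period bounds the height difference of any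
two points of the curve, since the curve climbs from one to the other within a period. -/
theorem height_le_integral (hc : IsBoundaryCurve E L c) {a b : ℝ} :
    (c a).2 - (c b).2 ≤ ∫ s in (0 : ℝ)..L, max (normal c s).1 0 := by
  have hn := hc.continuous_normal
  have hcont : Continuous fun s => max (normal c s).1 0 := hn.fst.max continuous_const
  have hper : Function.Periodic (fun s => max (normal c s).1 0) L := fun s => by
    simp only [hc.periodic_normal s]
  obtain ⟨a', ha', hca⟩ := hc.periodic.exists_mem_Ico hc.length_pos a b
  rw [hca]
  have h1 : (c a').2 - (c b).2 = ∫ s in b..a', (normal c s).1 :=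
    (intervalIntegral.integral_eq_sub_of_hasDerivAt (fun s _ => hc.hasDerivAt_snd s)
      (hc.continuous_deriv.snd.intervalIntegrable _ _)).symm
  have h2 : ∫ s in b..a', (normal c s).1 ≤ ∫ s in b..a', max (normal c s).1 0 :=
    intervalIntegral.integral_mono_on ha'.1 (hn.fst.intervalIntegrable _ _)
      (hcont.intervalIntegrable _ _) fun s _ => le_max_left _ _
  have h3 : ∫ s in b..a', max (normal c s).1 0 ≤ ∫ s in b..b + L, max (normal c s).1 0 :=
    intervalIntegral.integral_mono_interval le_rfl ha'.1 ha'.2.le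
      (Eventually.of_forall fun s => le_max_right _ _) (hcont.intervalIntegrable _ _)
  have h4 := hper.intervalIntegral_add_eq b 0
  rw [zero_add] at h4
  linarith

end IsBoundaryCurve

/-! ### Area integrals over the cross-section -/

namespace IsCrossSection

variable {E : Set (ℝ × ℝ)}

theorem closure_ae_eq (hE : IsCrossSection E) :
    (closure E : Set (ℝ × ℝ)) =ᵐ[(volume : Measure (ℝ × ℝ))] E :=
  closure_ae_eq_of_null_frontier (hE.convex.addHaar_frontier volume)

theorem area_eq (hE : IsCrossSection E) :
    area E = (volume : Measure (ℝ × ℝ)).real (closure E) :=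
  (measureReal_congr hE.closure_ae_eq).symm

theorem area_pos (hE : IsCrossSection E) : 0 < area E := by
  rw [hE.area_eq]
  refine ENNReal.toReal_pos ?_ hE.isCompact_closure.measure_lt_top.ne
  exact (Measure.measure_pos_of_nonempty_interior _
    (hE.interior_nonempty.mono (interior_mono subset_closure))).ne'

theorem integrableOn_fst (hE : IsCrossSection E) :
    IntegrableOn (fun p : ℝ × ℝ => p.1) (closure E) :=
  continuous_fst.continuousOn.integrableOn_compact hE.isCompact_closure

theorem integrableOn_inv_sq (hE : IsCrossSection E) :
    IntegrableOn (fun p : ℝ × ℝ => 1 / p.1 ^ 2) (closure E) := by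
  refine ContinuousOn.integrableOn_compact hE.isCompact_closure ?_
  refine continuousOn_const.div (continuous_fst.pow 2).continuousOn fun p hp => ?_
  exact pow_ne_zero 2 (ne_of_gt (hE.closure_subset hp))

theorem integral_fst (hE : IsCrossSection E) :
    ∫ p in closure E, p.1 = majorRadius E * area E := by
  have h := hE.area_pos
  rw [majorRadius, setIntegral_congr_set hE.closure_ae_eq]
  field_simp

theorem majorRadius_pos (hE : IsCrossSection E) : 0 < majorRadius E := by
  have h : 0 < ∫ p in closure E, p.1 := by
    rw [setIntegral_pos_iff_support_of_nonneg_ae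
      ((ae_restrict_iff' isClosed_closure.measurableSet).2
        (Eventually.of_forall fun p hp => (hE.closure_subset hp).le)) hE.integrableOn_fst]
    refine (Measure.measure_pos_of_nonempty_interior volume
      (hE.interior_nonempty.mono (interior_mono subset_closure))).trans_le (measure_mono ?_)
    exact fun p hp => ⟨(hE.closure_subset hp).ne', hp⟩
  rw [hE.integral_fst] at h
  exact pos_of_mul_pos_left h hE.area_pos.le

/-- Jensen's inequality for `r ↦ r⁻²`, by integrating its tangent at the mean radius. -/
theorem area_div_sq_le (hE : IsCrossSection E) :
    area E / majorRadius E ^ 2 ≤ ∫ p in closure E, 1 / p.1 ^ 2 := by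
  have hR := hE.majorRadius_pos
  have hA := hE.area_pos
  set R := majorRadius E
  have hfin : IsFiniteMeasure (volume.restrict (closure E)) :=
    ⟨by simpa using hE.isCompact_closure.measure_lt_top⟩
  have hi : IntegrableOn (fun p : ℝ × ℝ => 2 / R ^ 3 * p.1) (closure E) :=
    hE.integrableOn_fst.const_mul _
  have h : ∫ p in closure E, (3 / R ^ 2 - 2 / R ^ 3 * p.1) ≤ ∫ p in closure E, 1 / p.1 ^ 2 := by
    refine setIntegral_mono_on ((integrable_const _).sub hi) hE.integrableOn_inv_sq
      isClosed_closure.measurableSet fun p hp => ?_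
    have hp0 : 0 < p.1 := hE.closure_subset hp
    have e : 1 / p.1 ^ 2 - (3 / R ^ 2 - 2 / R ^ 3 * p.1) =
        (p.1 - R) ^ 2 * (2 * p.1 + R) / (p.1 ^ 2 * R ^ 3) := by
      field_simp
      ring
    have : 0 ≤ (p.1 - R) ^ 2 * (2 * p.1 + R) / (p.1 ^ 2 * R ^ 3) := by positivity
    linarith
  rw [integral_sub (integrable_const _) hi, integral_const_mul, hE.integral_fst,
    setIntegral_const, ← hE.area_eq, smul_eq_mul] at h
  refine le_of_eq_of_le ?_ h
  change _ = area E * (3 / R ^ 2) - 2 / R ^ 3 * (R * area E)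
  field_simp
  ring

/-- The mean radius controls the largest radius `x.1`: contracting `E` to half its size towards `x`
gives a subset of a quarter of the area in which the radius is at least `x.1 / 2`. -/
theorem fst_le_majorRadius (hE : IsCrossSection E) {x : ℝ × ℝ} (hx : x ∈ closure E) :
    x.1 ≤ 8 * majorRadius E := by
  have hA := hE.area_pos
  set S := AffineMap.homothety x (1 / 2 : ℝ) '' closure E
  have hSc : IsCompact S := hE.isCompact_closure.image (AffineMap.homothety_continuous x _)
  have hform : ∀ y : ℝ × ℝ, AffineMap.homothety x (1 / 2 : ℝ) y =
      (1 / 2 : ℝ) • x + (1 / 2 : ℝ) • y := by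
    intro y
    rw [AffineMap.homothety_apply]
    ext <;> simp <;> ring
  have hSE : S ⊆ closure E := by
    rintro _ ⟨y, hy, rfl⟩
    rw [hform]
    exact hE.convex.closure hx hy (by norm_num) (by norm_num) (by norm_num)
  have hvol : (volume : Measure (ℝ × ℝ)).real S = area E / 4 := by
    rw [hE.area_eq, Measure.real, Measure.addHaar_image_homothety, ENNReal.toReal_mul, Measure.real]
    norm_num
    ring
  have hfin : IsFiniteMeasure (volume.restrict S) := ⟨by simpa using hSc.measure_lt_top⟩
  have h1 : ∫ _ in S, x.1 / 2 ≤ ∫ p in S, p.1 := by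
    refine setIntegral_mono_on (integrable_const _) (hE.integrableOn_fst.mono_set hSE)
      hSc.isClosed.measurableSet ?_
    rintro _ ⟨y, hy, rfl⟩
    have hy0 : 0 < y.1 := hE.closure_subset hy
    rw [hform]
    simp only [Prod.fst_add, Prod.smul_fst, smul_eq_mul]
    linarith
  have h2 : ∫ p in S, p.1 ≤ ∫ p in closure E, p.1 :=
    setIntegral_mono_set hE.integrableOn_fst ((ae_restrict_iff' isClosed_closure.measurableSet).2
      (Eventually.of_forall fun p hp => (hE.closure_subset hp).le)) hSE.eventuallyLE
  rw [setIntegral_const, hvol, smul_eq_mul] at h1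
  rw [hE.integral_fst] at h2
  have h3 : area E * (x.1 / 8) ≤ area E * majorRadius E := by linarith
  have h4 := le_of_mul_le_mul_left h3 hA
  linarith

theorem area_le (hE : IsCrossSection E) {r₁ z₀ z₁ : ℝ} (hr : ∀ x ∈ closure E, x.1 ≤ r₁)
    (h₀ : ∀ x ∈ closure E, z₀ ≤ x.2) (h₁ : ∀ x ∈ closure E, x.2 ≤ z₁) :
    area E ≤ r₁ * (z₁ - z₀) := by
  obtain ⟨q, hq⟩ := hE.interior_nonempty
  have hq := subset_closure (interior_subset hq)
  have hsub : closure E ⊆ Icc 0 r₁ ×ˢ Icc z₀ z₁ := fun x hx =>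
    ⟨⟨(hE.closure_subset hx).le, hr x hx⟩, h₀ x hx, h₁ x hx⟩
  have hr0 : 0 ≤ r₁ := (hE.closure_subset hq).le.trans (hr q hq)
  have hz : z₀ ≤ z₁ := (h₀ q hq).trans (h₁ q hq)
  have h := measureReal_mono (μ := (volume : Measure (ℝ × ℝ))) hsub
    (isCompact_Icc.prod isCompact_Icc).measure_lt_top.ne
  rw [← hE.area_eq, Measure.volume_eq_prod, measureReal_prod_prod, Real.volume_real_Icc_of_le hr0,
    Real.volume_real_Icc_of_le hz] at h
  simpa using h

end IsCrossSection

theorem integral_Ici_inv_sq {r : ℝ} (hr : 0 < r) : ∫ x in Ici r, 1 / x ^ 2 = 1 / r := by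
  rw [integral_Ici_eq_integral_Ioi]
  have h := integral_Ioi_rpow_of_lt (a := -2) (by norm_num) hr
  have e : ∀ x ∈ Ioi r, 1 / x ^ 2 = x ^ (-2 : ℝ) := fun x hx => by
    rw [Real.rpow_neg (hr.trans hx).le, Real.rpow_two, one_div]
  rw [setIntegral_congr_fun measurableSet_Ioi e, h]
  norm_num [Real.rpow_neg_one]

theorem integrableOn_Ici_inv_sq {r : ℝ} (hr : 0 < r) :
    IntegrableOn (fun x : ℝ => 1 / x ^ 2) (Ici r) := by
  rw [integrableOn_Ici_iff_integrableOn_Ioi]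
  refine (integrableOn_Ioi_rpow_of_lt (a := -2) (by norm_num) hr).congr_fun (fun x hx => ?_)
    measurableSet_Ioi
  beta_reduce
  rw [Real.rpow_neg (hr.trans hx).le, Real.rpow_two, one_div]

namespace IsBoundaryCurve

variable {E : Set (ℝ × ℝ)} {L : ℝ} {c : ℝ → ℝ × ℝ}

/-- All of `E` lies on the far side of the inner arc, seen from the axis; integrating `r⁻²` first in
`r` over the half lines starting on the arc bounds its integral over `E`. -/
theorem integral_inv_sq_le (hE : IsCrossSection E) (hc : IsBoundaryCurve E L c) {a b : ℝ}
    (h : IsInnerArc E c a b) :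
    ∫ p in closure E, 1 / p.1 ^ 2 ≤ ∫ s in a..b, -(normal c s).1 / (c s).1 := by
  have hmeas : MeasurableSet (closure E) := isClosed_closure.measurableSet
  set F : ℝ × ℝ → ℝ := (closure E).indicator fun p => 1 / p.1 ^ 2 with hF
  have hFint : Integrable F := (integrable_indicator_iff hmeas).2 hE.integrableOn_inv_sq
  have hF0 : ∀ p, 0 ≤ F p := fun p => indicator_nonneg (fun p _ => by positivity) p
  set G : ℝ → ℝ := fun y => ∫ x, F (x, y) with hG
  have hGint : Integrable G := hFint.integral_prod_right
  have e1 : ∫ p in closure E, 1 / p.1 ^ 2 = ∫ y, G y := by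
    rw [← integral_indicator hmeas]
    exact integral_prod_symm F hFint
  have hanti : StrictAntiOn (fun s => (c s).2) (Icc a b) :=
    strictAntiOn_of_deriv_neg (convex_Icc a b) hc.continuous_curve.snd.continuousOn fun s hs => by
      rw [interior_Icc] at hs
      rw [(hc.hasDerivAt_snd s).deriv]
      exact h.deriv_neg s hs
  have himage : (fun s => (c s).2) '' Ioo a b = Ioo (c b).2 (c a).2 := by
    refine Subset.antisymm ?_
      (intermediate_value_Ioo' h.lt.le hc.continuous_curve.snd.continuousOn)
    rintro _ ⟨s, hs, rfl⟩
    exact ⟨hanti (Ioo_subset_Icc_self hs) (right_mem_Icc.2 h.lt.le) hs.2,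
      hanti (left_mem_Icc.2 h.lt.le) (Ioo_subset_Icc_self hs) hs.1⟩
  have e2 : ∫ y, G y = ∫ y in Ioo (c b).2 (c a).2, G y := by
    rw [← integral_Icc_eq_integral_Ioo, setIntegral_eq_integral_of_forall_compl_eq_zero]
    intro y hy
    have : ∀ x, F (x, y) = 0 := fun x => indicator_of_notMem
      (fun hxy => hy ⟨h.bot_le _ hxy, h.le_top _ hxy⟩) _
    simp [hG, this]
  have hderiv : ∀ s ∈ Ioo a b,
      HasDerivWithinAt (fun s => (c s).2) (deriv c s).2 (Ioo a b) s :=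
    fun s _ => (hc.hasDerivAt_snd s).hasDerivWithinAt
  have hinj : InjOn (fun s => (c s).2) (Ioo a b) := hanti.injOn.mono Ioo_subset_Icc_self
  have hGimg := (integrableOn_image_iff_integrableOn_abs_deriv_smul measurableSet_Ioo hderiv hinj
    G).1 hGint.integrableOn
  have hcont : Continuous fun s => -(normal c s).1 / (c s).1 :=
    hc.continuous_normal.fst.neg.div hc.continuous_curve.fst fun s => (hc.fst_pos hE s).ne'
  rw [e1, e2, ← himage, integral_image_eq_integral_abs_deriv_smul measurableSet_Ioo hderiv hinj,
    intervalIntegral.integral_of_le h.lt.le, integral_Ioc_eq_integral_Ioo]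
  refine setIntegral_mono_on hGimg ?_ measurableSet_Ioo fun s hs => ?_
  · exact (hcont.continuousOn.integrableOn_compact isCompact_Icc).mono_set Ioo_subset_Icc_self
  have hneg := h.deriv_neg s hs
  have hr := hc.fst_pos hE s
  have hle : G (c s).2 ≤ 1 / (c s).1 := by
    rw [← integral_Ici_inv_sq hr, ← integral_indicator measurableSet_Ici]
    refine integral_mono_of_nonneg (Eventually.of_forall fun x => hF0 _)
      ((integrable_indicator_iff measurableSet_Ici).2 (integrableOn_Ici_inv_sq hr))
      (Eventually.of_forall fun x => ?_)
    by_cases hx : (x, (c s).2) ∈ closure E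
    · have hsup := hc.support hE s hx
      simp only [normal, sub_self, mul_zero, add_zero] at hsup
      have hxr : x ∈ Ici (c s).1 := by
        rw [mem_Ici]
        nlinarith
      simp only [hF, indicator_of_mem hx, indicator_of_mem hxr, le_refl]
    · simp only [hF, indicator_of_notMem hx]
      exact indicator_nonneg (fun x _ => by positivity) x
  rw [abs_of_neg hneg, smul_eq_mul, neg_div, ← neg_mul_eq_neg_mul, neg_le_neg_iff]
  simp only [normal]
  rw [div_eq_mul_one_div]
  exact mul_le_mul_of_nonpos_left hle hneg.le

end IsBoundaryCurve

/-! ### The geometric and the dynamic estimate -/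

/-- A thick cross-section has a boundary point `c s₀` with strongly negative mean curvature. The
number `h` is the height of the cross-section, and `s₀` minimises the mean curvature on the inner
arc, along which `-n_r / r = κ - H`. The integral of this quantity exceeds `∫_E r⁻² ≥ 2π`, of which the
curvature accounts for at most `π`, so the rest must come from `-H`. -/
theorem IsBoundaryCurve.exists_meanCurvature_le {E : Set (ℝ × ℝ)} {L : ℝ} {c : ℝ → ℝ × ℝ}
    (hE : IsCrossSection E) (hc : IsBoundaryCurve E L c)
    (hthick : 2 * Real.pi * majorRadius E ^ 2 ≤ area E) :
    ∃ s₀ h, 0 < -meanCurvature c s₀ ∧ 0 < h ∧ Real.sqrt (area E) ≤ 4 * h ∧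
      h ≤ ∫ s in (0 : ℝ)..L, max (normal c s).1 0 ∧
      1 + thickness E ≤ 60 * h * -meanCurvature c s₀ := by
  obtain ⟨a, b, harc⟩ := hc.exists_isInnerArc hE
  obtain ⟨s₁, hs₁⟩ := hc.exists_isMaxOn hE fst_ne_zero
  simp only [ContinuousLinearMap.coe_fst'] at hs₁
  have hR := hE.majorRadius_pos
  have hA := hE.area_pos
  have hpi := Real.pi_gt_d2
  have hpi' := Real.pi_lt_d2
  set h := (c a).2 - (c b).2 with hh
  have hpos : 0 < h := sub_pos.2 harc.bot_lt_top
  set r₁ := (c s₁).1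
  have hr : 0 < r₁ := hc.fst_pos hE s₁
  have harea : area E ≤ r₁ * h := hE.area_le hs₁ harc.bot_le harc.le_top
  -- `2π (r₁ / 8)² ≤ 2π R² ≤ |E| ≤ r₁ h`
  have hrh : r₁ ≤ 11 * h := by
    have h1 : r₁ ≤ 8 * majorRadius E := hE.fst_le_majorRadius (hc.mem_closure s₁)
    have h2 : (r₁ / 8) ^ 2 ≤ majorRadius E ^ 2 := by
      apply pow_le_pow_left₀ (by positivity)
      linarith
    have h3 : 2 * 3.14 * (r₁ / 8) ^ 2 ≤ r₁ * h := by
      have : 2 * 3.14 * (r₁ / 8) ^ 2 ≤ 2 * Real.pi * majorRadius E ^ 2 := by gcongr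
      linarith
    have h4 : r₁ * (3.14 / 32 * r₁) ≤ r₁ * h := by linarith
    have h5 := le_of_mul_le_mul_left h4 hr
    linarith
  have hD : ∀ s, |(c s).1 - (c a).1| + |(c s).2 - (c a).2| ≤ 12 * h := by
    intro s
    have e1 : |(c s).1 - (c a).1| ≤ r₁ := by
      rw [abs_le]
      constructor <;> linarith [hs₁ _ (hc.mem_closure s), hs₁ _ (hc.mem_closure a),
        hc.fst_pos hE s, hc.fst_pos hE a]
    have e2 : |(c s).2 - (c a).2| ≤ h := by
      rw [abs_le]
      constructor <;> linarith [harc.le_top _ (hc.mem_closure s), harc.bot_le _ (hc.mem_closure s)]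
    linarith
  have hlen := hc.innerArc_length_le hE harc hD
  have hcurv := hc.integral_curvature_le harc
  have hcH := hc.continuous_meanCurvature hE
  obtain ⟨s₀, -, hs₀⟩ := isCompact_Icc.exists_isMinOn (nonempty_Icc.2 harc.lt.le)
    hcH.continuousOn
  have hint : ∫ s in a..b, -(normal c s).1 / (c s).1 ≤
      (∫ s in a..b, curvature c s) + (b - a) * -meanCurvature c s₀ := by
    have e1 : ∫ s in a..b, -(normal c s).1 / (c s).1 =
        ∫ s in a..b, (curvature c s - meanCurvature c s) :=
      intervalIntegral.integral_congr fun s _ => by simp only [meanCurvature]; ring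
    have e2 : -∫ s in a..b, meanCurvature c s ≤ (b - a) * -meanCurvature c s₀ := by
      have := intervalIntegral.integral_mono_on (μ := volume) harc.lt.le
        (intervalIntegrable_const (c := meanCurvature c s₀))
        (hcH.intervalIntegrable a b) fun s hs => hs₀ hs
      rw [intervalIntegral.integral_const, smul_eq_mul] at this
      linarith
    rw [e1, intervalIntegral.integral_sub (hc.continuous_curvature.intervalIntegrable _ _)
      (hcH.intervalIntegrable _ _)]
    linarith
  have hT : ∫ p in closure E, 1 / p.1 ^ 2 = thickness E + 2 * Real.pi := by
    rw [thickness, setIntegral_congr_set hE.closure_ae_eq]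
    ring
  have hJ : 2 * Real.pi ≤ thickness E + 2 * Real.pi := by
    rw [← hT]
    refine le_trans ?_ hE.area_div_sq_le
    rw [le_div_iff₀ (by positivity)]
    exact hthick
  have hmain := hc.integral_inv_sq_le hE harc
  rw [hT] at hmain
  set M := -meanCurvature c s₀
  have hM : 1 + thickness E ≤ (b - a) * M := by linarith
  have hba : 0 < b - a := sub_pos.2 harc.lt
  have hMpos : 0 < M := pos_of_mul_pos_right (by linarith : 0 < (b - a) * M) hba.le
  refine ⟨s₀, h, hMpos, hpos, ?_, hc.height_le_integral, hM.trans ?_⟩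
  · rw [Real.sqrt_le_left (by positivity)]
    nlinarith
  · apply mul_le_mul_of_nonneg_right _ hMpos.le
    nlinarith

/-- The dynamic boundary condition at any one point `c s₀` bounds the constant `lam` from below. As `H ≥ 0`
where the normal points away from the axis, this bounds the speed there from below, and hence the
circulation: the speed has one sign, and `W n_r` integrates to zero. -/
theorem IsSolution.circulation_ge {σ ρ : ℝ} (hσ : 0 < σ) (hρ : 0 < ρ) {E : Set (ℝ × ℝ)} {L : ℝ}
    {c : ℝ → ℝ × ℝ} {ψ : ℝ × ℝ → ℝ} {W γ lam : ℝ} (hs : IsSolution σ ρ E L c ψ W γ lam)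
    (hΨ : ∀ s, normalDeriv c (movingStream ψ W) s ≤ 0) (s₀ : ℝ) :
    Real.sqrt (2 * σ * -meanCurvature c s₀ / ρ) * ∫ s in (0 : ℝ)..L, max (normal c s).1 0 ≤
      circulation L c ψ := by
  have hE := hs.crossSection
  have hc := hs.boundary
  have hn := hc.continuous_normal
  -- the tangential velocity in the moving frame, `r⁻¹ ∂ₙΨ`
  set u : ℝ → ℝ := fun s => 1 / (c s).1 * normalDeriv c ψ s - W * (normal c s).1 with hu
  have hu_nonpos : ∀ s, u s ≤ 0 := by
    intro s
    have hr := hc.fst_pos hE s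
    have h1 : HasDerivWithinAt (fun t : ℝ => W / 2 * ((c s).1 + t * (normal c s).1) ^ 2)
        (W * (c s).1 * (normal c s).1) (Ici 0) 0 := by
      have h2 : HasDerivAt (fun t : ℝ => (c s).1 + t * (normal c s).1) (normal c s).1 0 := by
        simpa using ((hasDerivAt_id (0 : ℝ)).mul_const (normal c s).1).const_add (c s).1
      refine ((h2.pow 2).const_mul (W / 2)).hasDerivWithinAt.congr_deriv ?_
      simp
      ring
    have h3 : normalDeriv c (movingStream ψ W) s =
        normalDeriv c ψ s - W * (c s).1 * (normal c s).1 :=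
      ((hs.normal_differentiable s).hasDerivWithinAt.sub h1).derivWithin
        (uniqueDiffOn_Ici 0 0 self_mem_Ici)
    have h4 : u s = normalDeriv c (movingStream ψ W) s / (c s).1 := by
      rw [h3]
      simp only [hu]
      field_simp
    rw [h4]
    exact div_nonpos_of_nonpos_of_nonneg (hΨ s) hr.le
  have hjump : ∀ s, ρ * u s ^ 2 = 2 * σ * meanCurvature c s + lam := fun s => by
    linarith [hs.jump s]
  have hu_eq : ∀ s, -u s = Real.sqrt ((2 * σ * meanCurvature c s + lam) / ρ) := by
    intro s
    rw [← hjump s, mul_div_cancel_left₀ _ hρ.ne', Real.sqrt_sq_eq_abs, abs_of_nonpos (hu_nonpos s)]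
  have hcont : Continuous fun s => -u s := by
    have := hc.continuous_meanCurvature hE
    rw [funext hu_eq]
    fun_prop
  have hzero : ∫ s in (0 : ℝ)..L, (normal c s).1 = 0 := by
    have h1 : ∫ s in (0 : ℝ)..L, (normal c s).1 = (c L).2 - (c 0).2 :=
      intervalIntegral.integral_eq_sub_of_hasDerivAt (fun s _ => hc.hasDerivAt_snd s)
        (hn.fst.intervalIntegrable _ _)
    have h2 := hc.periodic 0
    rw [zero_add] at h2
    rw [h1, h2, sub_self]
  have hcirc : circulation L c ψ = ∫ s in (0 : ℝ)..L, -u s := by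
    have e : ∀ s, 1 / (c s).1 * normalDeriv c ψ s = W * (normal c s).1 - -u s := fun s => by
      simp only [hu]
      ring
    simp only [circulation, e]
    have hi : IntervalIntegrable (fun s => W * (normal c s).1) volume 0 L :=
      (continuous_const.mul hn.fst).intervalIntegrable _ _
    rw [intervalIntegral.integral_sub hi (hcont.intervalIntegrable _ _),
      intervalIntegral.integral_const_mul, hzero]
    ring
  have hlam : 2 * σ * -meanCurvature c s₀ ≤ lam := by
    have := hjump s₀
    have : 0 ≤ ρ * u s₀ ^ 2 := by positivity
    linarith
  rw [hcirc, ← intervalIntegral.integral_const_mul]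
  refine intervalIntegral.integral_mono_on hc.length_pos.le
    ((continuous_const.mul (hn.fst.max continuous_const)).intervalIntegrable _ _)
    (hcont.intervalIntegrable _ _) fun s _ => ?_
  rw [hu_eq s]
  rcases le_total (normal c s).1 0 with h | h
  · rw [max_eq_right h, mul_zero]
    exact Real.sqrt_nonneg _
  · have hn1 : (normal c s).1 ≤ 1 := by
      have := hc.unit_speed s
      simp only [normal]
      nlinarith [sq_nonneg (deriv c s).1]
    have hH := hc.meanCurvature_nonneg hE h
    have hmono : Real.sqrt (2 * σ * -meanCurvature c s₀ / ρ) ≤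
        Real.sqrt ((2 * σ * meanCurvature c s + lam) / ρ) := by
      apply Real.sqrt_le_sqrt
      gcongr
      nlinarith [mul_nonneg hσ.le hH]
    rw [max_eq_left h]
    exact (mul_le_of_le_one_right (Real.sqrt_nonneg _) hn1).trans hmono

end BubbleRing

theorem corollary1 :
    ∃ C : ℝ, 0 < C ∧
      ∀ (σ ρ : ℝ), 0 < σ → 0 < ρ →
      ∀ (E : Set (ℝ × ℝ)) (L : ℝ) (c : ℝ → ℝ × ℝ) (ψ : ℝ × ℝ → ℝ) (W γ lam : ℝ),
        BubbleRing.IsSolution σ ρ E L c ψ W γ lam →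
        (∀ s, BubbleRing.normalDeriv c (BubbleRing.movingStream ψ W) s ≤ 0) →
        2 * Real.pi * BubbleRing.majorRadius E ^ 2 ≤ BubbleRing.area E →
        C * (1 + BubbleRing.thickness E) ≤ BubbleRing.weber σ ρ E L c ψ := by
  refine ⟨1 / 120, by norm_num, ?_⟩
  intro σ ρ hσ hρ E L c ψ W γ lam hs hΨ hthick
  obtain ⟨s₀, h, hM, hh, hsqrt, hint, hδ⟩ :=
    hs.boundary.exists_meanCurvature_le hs.crossSection hthick
  have hcirc := hs.circulation_ge hσ hρ hΨ s₀
  set M := -BubbleRing.meanCurvature c s₀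
  set β := BubbleRing.circulation L c ψ
  have hA := hs.crossSection.area_pos
  have hβ : Real.sqrt (2 * σ * M / ρ) * h ≤ β :=
    (mul_le_mul_of_nonneg_left hint (Real.sqrt_nonneg _)).trans hcirc
  have hβ2 : 2 * σ * M * h ^ 2 ≤ ρ * β ^ 2 := by
    have h1 := pow_le_pow_left₀ (by positivity) hβ 2
    rw [mul_pow, Real.sq_sqrt (by positivity)] at h1
    calc 2 * σ * M * h ^ 2 = ρ * (2 * σ * M / ρ * h ^ 2) := by field_simp
      _ ≤ ρ * β ^ 2 := by gcongr
  have hpi : 1 ≤ Real.sqrt (2 * Real.pi) := Real.one_le_sqrt.2 (by linarith [Real.pi_gt_three])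
  calc 1 / 120 * (1 + BubbleRing.thickness E) ≤ 1 / 120 * (60 * h * M) := by gcongr
    _ = 1 * (2 * σ * M * h ^ 2) / (σ * (4 * h)) := by field_simp; norm_num
    _ ≤ Real.sqrt (2 * Real.pi) * (ρ * β ^ 2) / (σ * Real.sqrt (BubbleRing.area E)) := by
        gcongr
    _ = BubbleRing.weber σ ρ E L c ψ := by
        rw [BubbleRing.weber, mul_assoc (Real.sqrt _)]
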